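/- Setting. $\mathcal D'(\mathbb R)$ is the space of complex-valued distributions on $\mathbb R$. Let $\mathcal E_M(\mathbb R)$ be the algebra of nets $(u_\varepsilon)_{\varepsilon\in(0,1]}$ of smooth functions $u_\varepsilon:\mathbb R\to\mathbb C$ such that for every compact $K\subset\mathbb R$ and $k\in\mathbb N_0$ there is $N\ge 0$ with $\sup_{K}|u_\varepsilon^{(k)}|=O(\varepsilon^{-N})$ as $\varepsilon\to0$, let $\mathcal N(\mathbb R)$ be the ideal of those nets for which $\sup_{K}|u_\varepsilon^{(k)}|=O(\varepsilon^{m})$ for all $K$, $k$ and all $m\ge 0$, and let $\mathcal G(\mathbb R)=\mathcal E_M(\mathbb R)/\mathcal N(\mathbb R)$ be the special Colombeau algebra, with operations and differentiation defined componentwise; smooth functions (such as $x$) are regarded as elements of $\mathcal G(\mathbb R)$ via constant nets. For $u,v\in\mathcal G(\mathbb R)$ with representatives $(u_\varepsilon)_\varepsilon$, $(v_\varepsilon)_\varepsilon$, write $u\approx v$ ($u$ is associated to $v$) if $\int_{\mathbb R}(u_\varepsilon-v_\varepsilon)\varphi\,dx\to0$ as $\varepsilon\to0$ for all test functions $\varphi\in\mathcal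 D(\mathbb R)$; this does not depend on the representatives. Let $\rho\in\mathcal S(\mathbb R)$ satisfy $\int\rho\,dx=1$ and $\int x^k\rho(x)\,dx=0$ for all $k\ge1$, and put $\rho_\varepsilon(x)=\varepsilon^{-1}\rho(x/\varepsilon)$. Let $(U_j)_{j\in J}$ be a covering of $\mathbb R$ by relatively compact open sets, $(\chi_j)_{j\in J}$ a smooth partition of unity with $\operatorname{supp}\chi_j\subset U_j$, and $\psi_j\in\mathcal D(\mathbb R)$ with $\psi_j=1$ in a neighborhood of $\overline{U_j}$. The corresponding embedding $\iota:\mathcal D'(\mathbb R)\to\mathcal G(\mathbb R)$ is $$\iota(w)=\Big[\Big(\sum_{j\in J}\chi_j\cdot\big((\psi_j w)*\rho_\varepsilon\big)\Big)_{\varepsilon}\Big].$$ Theorem. Let $w\in\mathcal D'(\mathbb R)$, $u=\iota(w)$ and $\alpha\in\mathbb R$. The following are equivalent: 1. $w$ solves $xw'=\alpha w$ in $\mathcal D'(\mathbb R)$; 2. $u$ solves $xu'\approx\alpha u$ in $\mathcal G(\mathbb R)$. -/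

import Mathlib

open scoped Distributions SchwartzMap LineDeriv Manifold ContDiff Topology

noncomputable section

namespace Colombeau

/-! ### The special Colombeau algebra on the real line -/

/-- The parameter interval `(0, 1]`. -/
abbrev Eps : Type := Set.Ioc (0 : ℝ) 1

/-- The filter `ε → 0` on `(0, 1]`. -/
def epsZero : Filter Eps := Filter.comap Subtype.val (𝓝 0)

/-- Nets `(u_ε)` of complex valued functions on the real line, indexed by `ε ∈ (0, 1]`. -/
abbrev Net : Type := Eps → ℝ → ℂ

/-- Moderate nets of smooth functions: on each compact set, each derivative is `O(ε ^ (-N))`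
uniformly, for some `N`. -/
structure IsModerate (u : Net) : Prop where
  smooth : ∀ ε, ContDiff ℝ ∞ (u ε)
  bound : ∀ K : Set ℝ, IsCompact K → ∀ k : ℕ, ∃ N : ℕ, ∃ C : ℝ, ∀ᶠ ε in epsZero, ∀ x ∈ K,
    ‖iteratedDeriv k (u ε) x‖ ≤ C * ((ε : ℝ)⁻¹) ^ N

/-- Negligible nets of smooth functions: on each compact set, each derivative is `O(ε ^ m)`
uniformly, for all `m`. -/
structure IsNegligible (u : Net) : Prop where
  smooth : ∀ ε, ContDiff ℝ ∞ (u ε)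
  bound : ∀ K : Set ℝ, IsCompact K → ∀ k : ℕ, ∀ m : ℕ, ∃ C : ℝ, ∀ᶠ ε in epsZero, ∀ x ∈ K,
    ‖iteratedDeriv k (u ε) x‖ ≤ C * (ε : ℝ) ^ m

theorem Eps.pos (ε : Eps) : 0 < (ε : ℝ) := ε.2.1

theorem Eps.one_le_inv (ε : Eps) : 1 ≤ (ε : ℝ)⁻¹ := (one_le_inv₀ ε.pos).2 ε.2.2

theorem contDiffAt_of_smooth {f : ℝ → ℂ} (hf : ContDiff ℝ ∞ f) (k : ℕ) (x : ℝ) :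
    ContDiffAt ℝ (k : ℕ∞ω) f x :=
  (hf.of_le (by exact_mod_cast le_top)).contDiffAt

/-- All derivatives up to order `k` can be bounded with the same power of `ε`. -/
theorem IsModerate.bound_le {u : Net} (hu : IsModerate u) {K : Set ℝ} (hK : IsCompact K) (k : ℕ) :
    ∃ N : ℕ, ∃ C : ℝ, 0 ≤ C ∧ ∀ᶠ ε in epsZero, ∀ i ≤ k, ∀ x ∈ K,
      ‖iteratedDeriv i (u ε) x‖ ≤ C * ((ε : ℝ)⁻¹) ^ N := by
  choose N C h using hu.bound K hK
  refine ⟨∑ i ∈ Finset.range (k + 1), N i, ∑ i ∈ Finset.range (k + 1), |C i|,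
    Finset.sum_nonneg fun i _ => abs_nonneg _, ?_⟩
  have h' : ∀ᶠ ε in epsZero, ∀ i ∈ Finset.range (k + 1), ∀ x ∈ K,
      ‖iteratedDeriv i (u ε) x‖ ≤ C i * ((ε : ℝ)⁻¹) ^ N i :=
    (Filter.eventually_all_finset _).2 fun i _ => h i
  filter_upwards [h'] with ε hε i hi x hx
  have hi' : i ∈ Finset.range (k + 1) := Finset.mem_range.2 (by omega)
  have hinv := ε.one_le_inv
  calc ‖iteratedDeriv i (u ε) x‖ ≤ C i * ((ε : ℝ)⁻¹) ^ N i := hε i hi' x hx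
    _ ≤ |C i| * ((ε : ℝ)⁻¹) ^ N i := by gcongr; exact le_abs_self _
    _ ≤ |C i| * ((ε : ℝ)⁻¹) ^ (∑ i ∈ Finset.range (k + 1), N i) := by
        gcongr
        exact Finset.single_le_sum (f := N) (fun _ _ => Nat.zero_le _) hi'
    _ ≤ _ := by
        gcongr
        exact Finset.single_le_sum (f := fun i => |C i|) (fun _ _ => abs_nonneg _) hi'

/-- All derivatives up to order `k` can be bounded with the same constant. -/
theorem IsNegligible.bound_le {u : Net} (hu : IsNegligible u) {K : Set ℝ} (hK : IsCompact K)
    (k m : ℕ) : ∃ C : ℝ, 0 ≤ C ∧ ∀ᶠ ε in epsZero, ∀ i ≤ k, ∀ x ∈ K,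
      ‖iteratedDeriv i (u ε) x‖ ≤ C * (ε : ℝ) ^ m := by
  choose C h using fun i => hu.bound K hK i m
  refine ⟨∑ i ∈ Finset.range (k + 1), |C i|, Finset.sum_nonneg fun i _ => abs_nonneg _, ?_⟩
  have h' : ∀ᶠ ε in epsZero, ∀ i ∈ Finset.range (k + 1), ∀ x ∈ K,
      ‖iteratedDeriv i (u ε) x‖ ≤ C i * (ε : ℝ) ^ m :=
    (Filter.eventually_all_finset _).2 fun i _ => h i
  filter_upwards [h'] with ε hε i hi x hx
  have hi' : i ∈ Finset.range (k + 1) := Finset.mem_range.2 (by omega)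
  have hpos := ε.pos
  calc ‖iteratedDeriv i (u ε) x‖ ≤ C i * (ε : ℝ) ^ m := hε i hi' x hx
    _ ≤ _ := by
        gcongr
        exact (le_abs_self _).trans
          (Finset.single_le_sum (f := fun i => |C i|) (fun _ _ => abs_nonneg _) hi')

theorem norm_iteratedDeriv_mul_le {f g : ℝ → ℂ} (hf : ContDiff ℝ ∞ f) (hg : ContDiff ℝ ∞ g)
    {k : ℕ} {x A B : ℝ} (hA : ∀ i ≤ k, ‖iteratedDeriv i f x‖ ≤ A)
    (hB : ∀ i ≤ k, ‖iteratedDeriv i g x‖ ≤ B) :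
    ‖iteratedDeriv k (f * g) x‖ ≤ 2 ^ k * (A * B) := by
  have hA0 : 0 ≤ A := (norm_nonneg _).trans (hA 0 (Nat.zero_le _))
  rw [← norm_iteratedFDeriv_eq_norm_iteratedDeriv]
  refine (norm_iteratedFDeriv_mul_le hf hg x (by exact_mod_cast le_top)).trans ?_
  have h2 : (2 : ℝ) ^ k = ∑ i ∈ Finset.range (k + 1), (k.choose i : ℝ) := by
    exact_mod_cast (Nat.sum_range_choose k).symm
  rw [h2, Finset.sum_mul]
  refine Finset.sum_le_sum fun i hi => ?_
  rw [norm_iteratedFDeriv_eq_norm_iteratedDeriv, norm_iteratedFDeriv_eq_norm_iteratedDeriv, mul_assoc]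
  have hi' : i ≤ k := by have := Finset.mem_range.1 hi; omega
  gcongr
  · exact hA i hi'
  · exact hB _ (Nat.sub_le _ _)

theorem IsModerate.add {u v : Net} (hu : IsModerate u) (hv : IsModerate v) :
    IsModerate (u + v) := by
  refine ⟨fun ε => (hu.smooth ε).add (hv.smooth ε), fun K hK k => ?_⟩
  obtain ⟨N, C, hC, h⟩ := hu.bound_le hK k
  obtain ⟨N', C', hC', h'⟩ := hv.bound_le hK k
  refine ⟨N + N', C + C', ?_⟩
  filter_upwards [h, h'] with ε hε hε' x hx
  have hinv := ε.one_le_inv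
  rw [Pi.add_apply, iteratedDeriv_add (contDiffAt_of_smooth (hu.smooth ε) k x)
    (contDiffAt_of_smooth (hv.smooth ε) k x), add_mul]
  refine (norm_add_le _ _).trans (add_le_add ?_ ?_)
  · refine (hε k le_rfl x hx).trans ?_
    gcongr
    omega
  · refine (hε' k le_rfl x hx).trans ?_
    gcongr
    omega

theorem IsModerate.mul {u v : Net} (hu : IsModerate u) (hv : IsModerate v) :
    IsModerate (u * v) := by
  refine ⟨fun ε => (hu.smooth ε).mul (hv.smooth ε), fun K hK k => ?_⟩
  obtain ⟨N, C, hC, h⟩ := hu.bound_le hK k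
  obtain ⟨N', C', hC', h'⟩ := hv.bound_le hK k
  refine ⟨N + N', 2 ^ k * (C * C'), ?_⟩
  filter_upwards [h, h'] with ε hε hε' x hx
  refine (norm_iteratedDeriv_mul_le (hu.smooth ε) (hv.smooth ε) (fun i hi => hε i hi x hx)
    (fun i hi => hε' i hi x hx)).trans_eq ?_
  rw [pow_add]
  ring

/-- A smooth function, as a constant net, is moderate. -/
theorem isModerate_const {f : ℝ → ℂ} (hf : ContDiff ℝ ∞ f) : IsModerate fun _ => f := by
  refine ⟨fun _ => hf, fun K hK k => ⟨0, ?_⟩⟩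
  obtain ⟨C, hC⟩ := hK.exists_bound_of_continuousOn
    (hf.continuous_iteratedDeriv k (by exact_mod_cast le_top)).continuousOn
  exact ⟨C, Filter.Eventually.of_forall fun ε x hx => by simpa using hC x hx⟩

theorem IsNegligible.isModerate {u : Net} (hu : IsNegligible u) : IsModerate u :=
  ⟨hu.smooth, fun K hK k => ⟨0, by simpa using hu.bound K hK k 0⟩⟩

theorem isNegligible_zero : IsNegligible 0 :=
  ⟨fun _ => contDiff_const, fun K _ k m => ⟨0, Filter.Eventually.of_forall fun ε x _ => by
    simp⟩⟩

theorem IsNegligible.add {u v : Net} (hu : IsNegligible u) (hv : IsNegligible v) :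
    IsNegligible (u + v) := by
  refine ⟨fun ε => (hu.smooth ε).add (hv.smooth ε), fun K hK k m => ?_⟩
  obtain ⟨C, h⟩ := hu.bound K hK k m
  obtain ⟨C', h'⟩ := hv.bound K hK k m
  refine ⟨C + C', ?_⟩
  filter_upwards [h, h'] with ε hε hε' x hx
  rw [Pi.add_apply, iteratedDeriv_add (contDiffAt_of_smooth (hu.smooth ε) k x)
    (contDiffAt_of_smooth (hv.smooth ε) k x), add_mul]
  exact (norm_add_le _ _).trans (add_le_add (hε x hx) (hε' x hx))

theorem IsNegligible.mul_left {u v : Net} (hu : IsModerate u) (hv : IsNegligible v) :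
    IsNegligible (u * v) := by
  refine ⟨fun ε => (hu.smooth ε).mul (hv.smooth ε), fun K hK k m => ?_⟩
  obtain ⟨N, C, hC, h⟩ := hu.bound_le hK k
  obtain ⟨C', hC', h'⟩ := hv.bound_le hK k (N + m)
  refine ⟨2 ^ k * (C * C'), ?_⟩
  filter_upwards [h, h'] with ε hε hε' x hx
  refine (norm_iteratedDeriv_mul_le (hu.smooth ε) (hv.smooth ε) (fun i hi => hε i hi x hx)
    (fun i hi => hε' i hi x hx)).trans_eq ?_
  have hpos := ε.pos.ne'
  rw [pow_add, inv_pow]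
  field_simp

theorem IsModerate.deriv {u : Net} (hu : IsModerate u) : IsModerate fun ε => deriv (u ε) :=
  ⟨fun ε => (contDiff_infty_iff_deriv.1 (hu.smooth ε)).2, fun K hK k => by
    simpa only [iteratedDeriv_succ'] using hu.bound K hK (k + 1)⟩

theorem IsNegligible.deriv {u : Net} (hu : IsNegligible u) : IsNegligible fun ε => deriv (u ε) :=
  ⟨fun ε => (contDiff_infty_iff_deriv.1 (hu.smooth ε)).2, fun K hK k => by
    simpa only [iteratedDeriv_succ'] using hu.bound K hK (k + 1)⟩

/-- The algebra `𝓔_M(ℝ)` of moderate nets, with componentwise operations. -/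
def moderate : Subalgebra ℂ Net where
  carrier := {u | IsModerate u}
  mul_mem' := IsModerate.mul
  add_mem' := IsModerate.add
  algebraMap_mem' c := isModerate_const (f := fun _ => c) contDiff_const

/-- The ideal `𝓝(ℝ)` of negligible nets. -/
def negligible : Ideal moderate where
  carrier := {u | IsNegligible (u : Net)}
  zero_mem' := isNegligible_zero
  add_mem' := IsNegligible.add
  smul_mem' c _ hu := IsNegligible.mul_left c.2 hu

/-- The special Colombeau algebra `𝓖(ℝ) = 𝓔_M(ℝ) / 𝓝(ℝ)`. -/
abbrev ColombeauAlgebra : Type := moderate ⧸ negligible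

/-- The class in `𝓖(ℝ)` of a moderate net. -/
def mk (u : Net) (hu : IsModerate u) : ColombeauAlgebra :=
  Ideal.Quotient.mk negligible ⟨u, hu⟩

/-- Componentwise differentiation of moderate nets. -/
def netDeriv : moderate →ₗ[ℂ] moderate where
  toFun u := ⟨fun ε => deriv ((u : Net) ε), IsModerate.deriv u.2⟩
  map_add' u v := by
    ext ε x
    exact deriv_add ((u.2.smooth ε).differentiable (by simp) x)
      ((v.2.smooth ε).differentiable (by simp) x)
  map_smul' c u := by
    ext ε x
    exact deriv_const_smul c ((u.2.smooth ε).differentiable (by simp) x)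

/-- Differentiation in `𝓖(ℝ)`, induced by componentwise differentiation. -/
def D : ColombeauAlgebra →ₗ[ℂ] ColombeauAlgebra :=
  (Submodule.Quotient.restrictScalarsEquiv ℂ negligible).toLinearMap ∘ₗ
    (Submodule.mapQ (negligible.restrictScalars ℂ) (negligible.restrictScalars ℂ) netDeriv
      fun _ hu => IsNegligible.deriv hu) ∘ₗ
    (Submodule.Quotient.restrictScalarsEquiv ℂ negligible).symm.toLinearMap

theorem D_mk (u : Net) (hu : IsModerate u) :
    D (mk u hu) = mk (fun ε => deriv (u ε)) hu.deriv := rfl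

/-- The embedding `f ↦ [(f)_ε]` of the smooth functions into `𝓖(ℝ)` as constant nets. -/
def ofSmooth (f : ℝ → ℂ) (hf : ContDiff ℝ ∞ f) : ColombeauAlgebra :=
  mk (fun _ => f) (isModerate_const hf)

/-- The coordinate function `x`, as an element of `𝓖(ℝ)`. -/
def X : ColombeauAlgebra := ofSmooth (fun x => (x : ℂ)) Complex.ofRealCLM.contDiff

/-- Association in `𝓖(ℝ)`: `u ≈ v` means that `∫ (u_ε - v_ε) φ dx → 0` as `ε → 0` for all test
functions `φ`, for some (equivalently, for all) representatives of `u` and `v`. -/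
def Assoc (u v : ColombeauAlgebra) : Prop :=
  ∃ (f g : Net) (hf : IsModerate f) (hg : IsModerate g), u = mk f hf ∧ v = mk g hg ∧
    ∀ φ : 𝓓((⊤ : TopologicalSpace.Opens ℝ), ℝ),
      Filter.Tendsto (fun ε => ∫ x, (f ε x - g ε x) * (φ x : ℂ)) epsZero (𝓝 0)

/-! ### Distributions on the real line and their embedding -/

/-- The space `𝓓(ℝ)` of real valued test functions on the line. -/
abbrev Test : Type := 𝓓((⊤ : TopologicalSpace.Opens ℝ), ℝ)

/-- The space `𝓓(ℝ, ℂ)` of complex valued test functions on the line. -/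
abbrev TestC : Type := 𝓓((⊤ : TopologicalSpace.Opens ℝ), ℂ)

/-- The space `𝓓'(ℝ)` of complex valued distributions on the line. -/
abbrev Distr : Type := 𝓓'((⊤ : TopologicalSpace.Opens ℝ), ℂ)

section Product

open ContDiffMapSupportedIn

/-- The product of a test function supported in `K` with a smooth function. -/
def mulSupported {f : ℝ → ℝ} (hf : ContDiff ℝ ∞ f) (K : TopologicalSpace.Compacts ℝ) :
    𝓓_{K}(ℝ, ℝ) →L[ℝ] 𝓓_{K}(ℝ, ℝ) :=
  ContDiffMapSupportedIn.mkCLM ℝ (fun φ x => f x * φ x)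
    (fun φ ψ x => by simp [mul_add])
    (fun c φ x => by simp; ring)
    (fun φ => hf.mul φ.contDiff)
    (fun φ x hx => by simp [φ.zero_on_compl hx])
    (by
      intro i _
      have hb : ∀ j : ℕ, ∃ C, ∀ x ∈ (K : Set ℝ), ‖iteratedFDeriv ℝ j f x‖ ≤ C := fun j =>
        K.isCompact.exists_bound_of_continuousOn
          (hf.continuous_iteratedFDeriv (by exact_mod_cast le_top)).continuousOn
      choose C hC using hb
      refine ⟨Finset.range (i + 1), ∑ j ∈ Finset.range (i + 1), (i.choose j : ℝ) * |C j|,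
        Finset.sum_nonneg fun j _ => by positivity, fun φ x hx => ?_⟩
      refine (norm_iteratedFDeriv_mul_le hf φ.contDiff x (by exact_mod_cast le_top)).trans ?_
      rw [Finset.sum_mul]
      refine Finset.sum_le_sum fun j hj => ?_
      have hj' : i - j ∈ Finset.range (i + 1) := Finset.mem_range.2 (by omega)
      gcongr
      · exact (hC j x hx).trans (le_abs_self _)
      · exact (norm_iteratedFDeriv_apply_le_seminorm_top ℝ).trans
          (Seminorm.le_finset_sup_apply hj'))

/-- The product of a test function with a smooth function. -/
def mulTest {f : ℝ → ℝ} (hf : ContDiff ℝ ∞ f) : Test →L[ℝ] Test :=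
  TestFunction.limitCLM ℝ
    (fun φ => ⟨fun x => f x * φ x, hf.mul φ.contDiff, φ.hasCompactSupport.mul_left,
      (tsupport_mul_subset_right (f := f) (g := φ)).trans φ.tsupport_subset⟩)
    (fun K hK => (TestFunction.ofSupportedInCLM ℝ hK).comp (mulSupported hf K))
    (fun _ _ _ => rfl)

@[simp]
theorem mulTest_apply {f : ℝ → ℝ} (hf : ContDiff ℝ ∞ f) (φ : Test) (x : ℝ) :
    mulTest hf φ x = f x * φ x := rfl

/-- The product `f w` of a distribution `w` with a smooth function `f`,
`⟨f w, φ⟩ = ⟨w, f φ⟩`. -/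
def mulDistr {f : ℝ → ℝ} (hf : ContDiff ℝ ∞ f) (w : Distr) : Distr :=
  (mulTest hf).precompCompactConvergenceCLM ℂ w

@[simp]
theorem mulDistr_apply {f : ℝ → ℝ} (hf : ContDiff ℝ ∞ f) (w : Distr) (φ : Test) :
    mulDistr hf w φ = w (mulTest hf φ) := rfl

end Product

/-- The complex linear extension of a distribution to complex valued test functions,
`⟨w, φ⟩ = ⟨w, Re φ⟩ + i ⟨w, Im φ⟩`. -/
def pairing (w : Distr) : TestC →L[ℝ] ℂ :=
  (show Test →L[ℝ] ℂ from w).comp (TestFunction.postcompCLM Complex.reCLM) +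
    Complex.I • (show Test →L[ℝ] ℂ from w).comp (TestFunction.postcompCLM Complex.imCLM)

theorem pairing_apply (w : Distr) (φ : TestC) :
    pairing w φ = w (TestFunction.postcompCLM Complex.reCLM φ) +
      Complex.I * w (TestFunction.postcompCLM Complex.imCLM φ) := rfl

/-- The complex valued test function `ψ h`, for a test function `ψ` and a smooth function `h`. -/
def cutoff (ψ : Test) (h : ℝ → ℂ) (hh : ContDiff ℝ ∞ h) : TestC :=
  ⟨fun y => (ψ y : ℂ) * h y, (Complex.ofRealCLM.contDiff.comp ψ.contDiff).mul hh,
    (ψ.hasCompactSupport.comp_left (g := ((↑) : ℝ → ℂ)) rfl).mul_right, fun _ _ => trivial⟩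

@[simp]
theorem cutoff_apply (ψ : Test) (h : ℝ → ℂ) (hh : ContDiff ℝ ∞ h) (y : ℝ) :
    cutoff ψ h hh y = (ψ y : ℂ) * h y := rfl

/-- A smooth function all of whose derivatives are bounded. -/
structure IsBddSmooth (g : ℝ → ℂ) : Prop where
  smooth : ContDiff ℝ ∞ g
  bound : ∀ k, ∃ M, ∀ x, ‖iteratedDeriv k g x‖ ≤ M

theorem IsBddSmooth.deriv {g : ℝ → ℂ} (hg : IsBddSmooth g) : IsBddSmooth (deriv g) :=
  ⟨(contDiff_infty_iff_deriv.1 hg.smooth).2, fun k => by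
    simpa only [iteratedDeriv_succ'] using hg.bound (k + 1)⟩

theorem IsBddSmooth.iteratedDeriv {g : ℝ → ℂ} (hg : IsBddSmooth g) (n : ℕ) :
    IsBddSmooth (iteratedDeriv n g) := by
  induction n with
  | zero => simpa using hg
  | succ n ih => rw [iteratedDeriv_succ]; exact ih.deriv

theorem contDiff_reflect {g : ℝ → ℂ} (hg : ContDiff ℝ ∞ g) (x : ℝ) :
    ContDiff ℝ ∞ fun y => g (x - y) :=
  hg.comp (contDiff_const.sub contDiff_id)

/-- The convolution `(ψ w) * g` of the compactly supported distribution `ψ w` with a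
smooth function `g`, that is `x ↦ ⟨w, ψ g(x - ·)⟩`. -/
def conv (w : Distr) (ψ : Test) (g : ℝ → ℂ) (hg : ContDiff ℝ ∞ g) : ℝ → ℂ :=
  fun x => pairing w (cutoff ψ (fun y => g (x - y)) (contDiff_reflect hg x))

/-- Continuity of a distribution on the test functions supported in a compact set. -/
theorem exists_bound (T : TestC →L[ℝ] ℂ) (K : TopologicalSpace.Compacts ℝ) :
    ∃ m : ℕ, ∃ C : ℝ, 0 ≤ C ∧ ∀ φ : TestC, tsupport φ ⊆ K → ∀ B : ℝ, 0 ≤ B →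
      (∀ k ≤ m, ∀ x ∈ (K : Set ℝ), ‖iteratedDeriv k φ x‖ ≤ B) → ‖T φ‖ ≤ C * B := by
  let S : 𝓓_{K}(ℝ, ℂ) →L[ℝ] ℂ := T.comp (TestFunction.ofSupportedInCLM ℝ (fun _ _ => trivial))
  obtain ⟨s, C, -, hC⟩ := Seminorm.bound_of_continuous
    (ContDiffMapSupportedIn.withSeminorms ℝ ℝ ℂ ⊤ K) ((normSeminorm ℝ ℂ).comp S.toLinearMap)
    (continuous_norm.comp S.continuous)
  refine ⟨s.sup id, C, C.2, fun φ hφ B hB h => ?_⟩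
  let φK : 𝓓_{K}(ℝ, ℂ) := .of_support_subset φ.contDiff (subset_closure.trans hφ)
  have h1 : ‖T φ‖ ≤ C * (s.sup fun i => ContDiffMapSupportedIn.seminorm ℝ ℝ ℂ ⊤ K i) φK := hC φK
  refine h1.trans ?_
  have h2 : (s.sup fun i => ContDiffMapSupportedIn.seminorm ℝ ℝ ℂ ⊤ K i) φK ≤ B := by
    refine Seminorm.finset_sup_apply_le hB fun i hi => ?_
    rw [ContDiffMapSupportedIn.seminorm_top_le_iff ℝ hB]
    intro x hx
    rw [norm_iteratedFDeriv_eq_norm_iteratedDeriv]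
    exact h i (Finset.le_sup (f := id) hi) x hx
  have := C.2
  gcongr

/-- `h ↦ ⟨w, ψ h⟩` is bounded by finitely many derivatives of `h` on a compact set. -/
theorem exists_bound_cutoff (w : Distr) (ψ : Test) :
    ∃ m : ℕ, ∃ C : ℝ, 0 ≤ C ∧ ∀ (h : ℝ → ℂ) (hh : ContDiff ℝ ∞ h) (B : ℝ), 0 ≤ B →
      (∀ k ≤ m, ∀ y, ‖iteratedDeriv k h y‖ ≤ B) → ‖pairing w (cutoff ψ h hh)‖ ≤ C * B := by
  obtain ⟨m, C, hC, hb⟩ := exists_bound (pairing w) ⟨tsupport ψ, ψ.hasCompactSupport⟩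
  have hψ : ContDiff ℝ ∞ fun y => (ψ y : ℂ) := Complex.ofRealCLM.contDiff.comp ψ.contDiff
  have hA' : ∃ A, 0 ≤ A ∧ ∀ i ≤ m, ∀ x ∈ tsupport ψ, ‖iteratedDeriv i (fun y => (ψ y : ℂ)) x‖ ≤ A := by
    choose A hA using fun k => ψ.hasCompactSupport.isCompact.exists_bound_of_continuousOn
      (hψ.continuous_iteratedDeriv k (by exact_mod_cast le_top)).continuousOn
    refine ⟨∑ i ∈ Finset.range (m + 1), |A i|, Finset.sum_nonneg fun _ _ => abs_nonneg _,
      fun i hi x hx => ?_⟩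
    exact (hA i x hx).trans ((le_abs_self _).trans (Finset.single_le_sum (f := fun i => |A i|)
      (fun _ _ => abs_nonneg _) (Finset.mem_range.2 (by omega))))
  obtain ⟨A, hA, hA'⟩ := hA'
  refine ⟨m, C * (2 ^ m * A), by positivity, fun h hh B hB hbound => ?_⟩
  have := hb (cutoff ψ h hh) ?_ (2 ^ m * (A * B)) (by positivity) ?_
  · exact this.trans_eq (by ring)
  · refine closure_mono fun y hy => ?_
    rw [Function.mem_support] at hy ⊢
    intro h0
    exact hy (by simp [h0])
  · intro k hk x hx
    refine (norm_iteratedDeriv_mul_le hψ hh (fun i hi => hA' i (hi.trans hk) x hx)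
      (fun i hi => hbound i (hi.trans hk) x)).trans ?_
    gcongr
    · norm_num

theorem norm_taylor_le {G : ℝ → ℂ} (hG : ContDiff ℝ ∞ G) {M : ℝ}
    (hM : ∀ x, ‖iteratedDeriv 2 G x‖ ≤ M) (a t : ℝ) :
    ‖G (a + t) - G a - t * deriv G a‖ ≤ M * |t| * |t| := by
  have hd : ContDiff ℝ ∞ (deriv G) := (contDiff_infty_iff_deriv.1 hG).2
  have hM' : ∀ x, ‖deriv (deriv G) x‖ ≤ M := fun x => by
    have := hM x
    rwa [iteratedDeriv_succ, iteratedDeriv_one] at this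
  have hM0 : 0 ≤ M := (norm_nonneg _).trans (hM 0)
  have hlip : ∀ s, ‖deriv G (a + s) - deriv G a‖ ≤ M * |s| := fun s => by
    simpa using convex_univ.norm_image_sub_le_of_norm_deriv_le
      (f := deriv G) (x := a) (y := a + s) (C := M)
      (fun x _ => hd.differentiable (by simp) x) (fun x _ => hM' x) trivial trivial
  have hder : ∀ s : ℝ, HasDerivAt (fun s : ℝ => G (a + s) - s * deriv G a)
      (deriv G (a + s) - deriv G a) s := fun s => by
    have h1 : HasDerivAt (fun s => G (a + s)) (deriv G (a + s)) s :=
      ((hG.differentiable (by simp) (a + s)).hasDerivAt).comp_const_add a s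
    have h2 : HasDerivAt (fun s : ℝ => (s : ℂ) * deriv G a) (1 * deriv G a) s :=
      (Complex.ofRealCLM.hasDerivAt (x := s)).mul_const _
    rw [one_mul] at h2
    exact h1.sub h2
  have := (convex_Icc (-|t|) |t|).norm_image_sub_le_of_norm_deriv_le
    (f := fun s : ℝ => G (a + s) - s * deriv G a) (x := 0) (y := t) (C := M * |t|)
    (fun s _ => (hder s).differentiableAt)
    (fun s hs => by
      rw [(hder s).deriv]
      refine (hlip s).trans ?_
      have : |s| ≤ |t| := abs_le.2 hs
      gcongr)
    ⟨by simp, by simp⟩ ⟨neg_abs_le t, le_abs_self t⟩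
  simp only [add_zero, Complex.ofReal_zero, zero_mul, sub_zero, Real.norm_eq_abs] at this
  rwa [show G (a + t) - G a - t * deriv G a = G (a + t) - t * deriv G a - G a by ring]

theorem pairing_cutoff_taylor (w : Distr) (ψ : Test) {g : ℝ → ℂ} (hg : IsBddSmooth g) (x t : ℝ) :
    conv w ψ g hg.smooth (x + t) - conv w ψ g hg.smooth x -
        t * conv w ψ (deriv g) hg.deriv.smooth x =
      pairing w (cutoff ψ (fun y => g (x + t - y) - g (x - y) - t * deriv g (x - y))
        (((contDiff_reflect hg.smooth (x + t)).sub (contDiff_reflect hg.smooth x)).sub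
          (contDiff_const.mul (contDiff_reflect hg.deriv.smooth x)))) := by
  unfold conv
  rw [← Complex.real_smul, ← map_smul, ← map_sub, ← map_sub]
  congr 1
  ext y
  simp [Complex.real_smul]
  ring

theorem iteratedDeriv_sub_sub_mul {f g h : ℝ → ℂ} (hf : ContDiff ℝ ∞ f) (hg : ContDiff ℝ ∞ g)
    (hh : ContDiff ℝ ∞ h) (c : ℂ) (k : ℕ) (y : ℝ) :
    iteratedDeriv k (fun y => f y - g y - c * h y) y =
      iteratedDeriv k f y - iteratedDeriv k g y - c * iteratedDeriv k h y := by
  have hch : ContDiff ℝ ∞ fun y => c * h y := contDiff_const.mul hh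
  have e : (fun y => f y - g y - c * h y) = (f - g) - fun y => c * h y := rfl
  have hfg : ContDiff ℝ ∞ (f - g) := hf.sub hg
  rw [e, iteratedDeriv_sub (contDiffAt_of_smooth hfg k y) (contDiffAt_of_smooth hch k y),
    iteratedDeriv_sub (contDiffAt_of_smooth hf k y) (contDiffAt_of_smooth hg k y),
    iteratedDeriv_const_mul _ (contDiffAt_of_smooth hh k y)]

theorem hasDerivAt_conv (w : Distr) (ψ : Test) {g : ℝ → ℂ} (hg : IsBddSmooth g) (x : ℝ) :
    HasDerivAt (conv w ψ g hg.smooth) (conv w ψ (deriv g) hg.deriv.smooth x) x := by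
  obtain ⟨m, C, hC, hb⟩ := exists_bound_cutoff w ψ
  choose M hM using hg.bound
  have hM0 : ∀ k, 0 ≤ M k := fun k => (norm_nonneg _).trans (hM k 0)
  set A : ℝ := ∑ i ∈ Finset.range (m + 1), M (i + 2) with hA
  have hA0 : 0 ≤ A := Finset.sum_nonneg fun _ _ => hM0 _
  have key : ∀ t : ℝ, ‖conv w ψ g hg.smooth (x + t) - conv w ψ g hg.smooth x -
      t • conv w ψ (deriv g) hg.deriv.smooth x‖ ≤ C * A * |t| * |t| := by
    intro t
    rw [Complex.real_smul, pairing_cutoff_taylor w ψ hg]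
    refine (hb _ _ (A * |t| * |t|) (by positivity) fun k hk y => ?_).trans_eq (by ring)
    have hs1 := contDiff_reflect hg.smooth (x + t)
    have hs2 := contDiff_reflect hg.smooth x
    have hs3 := contDiff_reflect hg.deriv.smooth x
    have e : iteratedDeriv k (fun y => g (x + t - y) - g (x - y) - t * deriv g (x - y)) y =
        (-1) ^ k * (iteratedDeriv k g (x - y + t) - iteratedDeriv k g (x - y) -
          t * deriv (iteratedDeriv k g) (x - y)) := by
      rw [iteratedDeriv_sub_sub_mul hs1 hs2 hs3,
        iteratedDeriv_comp_const_sub, iteratedDeriv_comp_const_sub, iteratedDeriv_comp_const_sub]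
      simp only [← iteratedDeriv_succ', iteratedDeriv_succ, Complex.real_smul]
      rw [show x + t - y = x - y + t by ring]
      push_cast
      ring
    rw [e, norm_mul, norm_pow, norm_neg, norm_one, one_pow, one_mul]
    refine (norm_taylor_le (hg.iteratedDeriv k).smooth (M := M (k + 2)) (fun z => ?_) _ _).trans ?_
    · have : iteratedDeriv 2 (iteratedDeriv k g) z = iteratedDeriv (k + 2) g z := by
        simp [iteratedDeriv_succ]
      rw [this]
      exact hM _ _
    · gcongr
      exact Finset.single_le_sum (f := fun i => M (i + 2)) (fun _ _ => hM0 _)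
        (Finset.mem_range.2 (by omega))
  rw [hasDerivAt_iff_isLittleO_nhds_zero]
  refine Asymptotics.IsBigO.trans_isLittleO (g := fun t : ℝ => t * t) ?_ ?_
  · refine Asymptotics.IsBigO.of_bound (C * A) (Filter.Eventually.of_forall fun t => ?_)
    rw [norm_mul, Real.norm_eq_abs, ← mul_assoc]
    exact key t
  · simpa [pow_two] using (Asymptotics.isLittleO_pow_id (𝕜 := ℝ) (n := 2) (by norm_num))

theorem iteratedDeriv_conv (w : Distr) (ψ : Test) {g : ℝ → ℂ} (hg : IsBddSmooth g) (n : ℕ) :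
    iteratedDeriv n (conv w ψ g hg.smooth) =
      conv w ψ (iteratedDeriv n g) (hg.iteratedDeriv n).smooth := by
  induction n with
  | zero => ext x; simp only [iteratedDeriv_zero]
  | succ n ih =>
    rw [iteratedDeriv_succ, ih]
    ext x
    rw [(hasDerivAt_conv w ψ (hg.iteratedDeriv n) x).deriv]
    simp only [← iteratedDeriv_succ]

theorem contDiff_conv (w : Distr) (ψ : Test) {g : ℝ → ℂ} (hg : IsBddSmooth g) :
    ContDiff ℝ ∞ (conv w ψ g hg.smooth) := by
  refine contDiff_of_differentiable_iteratedDeriv fun n _ => ?_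
  rw [iteratedDeriv_conv w ψ hg]
  exact fun x => (hasDerivAt_conv w ψ (hg.iteratedDeriv n) x).differentiableAt

/-- The scaled mollifier `ρ_ε(x) = ε⁻¹ ρ(x / ε)`. -/
def scaled (ρ : 𝓢(ℝ, ℂ)) (ε : Eps) : ℝ → ℂ := fun x => ((ε : ℝ)⁻¹ : ℝ) • ρ (x / ε)

theorem contDiff_scaled (ρ : 𝓢(ℝ, ℂ)) (ε : Eps) : ContDiff ℝ ∞ (scaled ρ ε) :=
  ((ρ.smooth ⊤).comp (contDiff_id.div_const _)).const_smul ((ε : ℝ)⁻¹)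

theorem iteratedDeriv_scaled (ρ : 𝓢(ℝ, ℂ)) (ε : Eps) (k : ℕ) (x : ℝ) :
    iteratedDeriv k (scaled ρ ε) x =
      (((ε : ℝ)⁻¹) ^ (k + 1) : ℝ) • iteratedDeriv k ρ (x / ε) := by
  have h1 : scaled ρ ε = (ε : ℝ)⁻¹ • fun x => ρ ((ε : ℝ)⁻¹ * x) := by
    ext y
    simp [scaled, div_eq_inv_mul]
  have hs : ContDiff ℝ k ρ := (ρ.smooth k)
  have hs' : ContDiff ℝ k fun x => ρ ((ε : ℝ)⁻¹ * x) := hs.comp (contDiff_const.mul contDiff_id)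
  rw [h1, iteratedDeriv_const_smul hs'.contDiffAt]
  have h2 := iteratedDeriv_comp_const_smul hs (ε : ℝ)⁻¹
  have h3 := congrFun h2 x
  rw [h3, smul_smul, pow_succ', div_eq_inv_mul]

theorem exists_bound_scaled (ρ : 𝓢(ℝ, ℂ)) (k : ℕ) :
    ∃ M : ℝ, 0 ≤ M ∧ ∀ (ε : Eps) (x : ℝ),
      ‖iteratedDeriv k (scaled ρ ε) x‖ ≤ M * ((ε : ℝ)⁻¹) ^ (k + 1) := by
  obtain ⟨M, hM0, hM⟩ := ρ.decay 0 k
  refine ⟨M, hM0.le, fun ε x => ?_⟩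
  have hpos := ε.pos
  rw [iteratedDeriv_scaled, norm_smul, Real.norm_of_nonneg (by positivity), mul_comm]
  gcongr
  simpa [norm_iteratedFDeriv_eq_norm_iteratedDeriv] using hM (x / ε)

theorem isBddSmooth_scaled (ρ : 𝓢(ℝ, ℂ)) (ε : Eps) : IsBddSmooth (scaled ρ ε) :=
  ⟨contDiff_scaled ρ ε, fun k => by
    obtain ⟨M, -, hM⟩ := exists_bound_scaled ρ k
    exact ⟨_, hM ε⟩⟩

/-- The net `((ψ w) * ρ_ε)_ε` is moderate. -/
theorem isModerate_conv (ρ : 𝓢(ℝ, ℂ)) (w : Distr) (ψ : Test) :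
    IsModerate fun ε => conv w ψ (scaled ρ ε) (contDiff_scaled ρ ε) := by
  refine ⟨fun ε => contDiff_conv w ψ (isBddSmooth_scaled ρ ε), fun K _ n => ?_⟩
  obtain ⟨m, C, hC, hb⟩ := exists_bound_cutoff w ψ
  choose M hM0 hM using exists_bound_scaled ρ
  refine ⟨m + n + 1, C * ∑ k ∈ Finset.range (m + 1), M (k + n), Filter.Eventually.of_forall
    fun ε x _ => ?_⟩
  have hpos := ε.pos
  have hinv := ε.one_le_inv
  rw [iteratedDeriv_conv w ψ (isBddSmooth_scaled ρ ε), mul_assoc]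
  have hS0 : 0 ≤ ∑ k ∈ Finset.range (m + 1), M (k + n) := Finset.sum_nonneg fun _ _ => hM0 _
  refine hb _ _ _ (by positivity) fun k hk y => ?_
  have e : iteratedDeriv k (fun y => iteratedDeriv n (scaled ρ ε) (x - y)) y =
      (-1) ^ k * iteratedDeriv (k + n) (scaled ρ ε) (x - y) := by
    rw [iteratedDeriv_comp_const_sub]
    simp only [iteratedDeriv_eq_iterate, ← Function.iterate_add_apply]
    simp
  rw [e, norm_mul, norm_pow, norm_neg, norm_one, one_pow, one_mul]
  refine (hM (k + n) ε (x - y)).trans ?_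
  gcongr
  · exact Finset.single_le_sum (f := fun k => M (k + n)) (fun _ _ => hM0 _)
      (Finset.mem_range.2 (by omega))

/-- A Schwartz mollifier: it has integral one and all its higher moments vanish. -/
structure IsMollifier (ρ : 𝓢(ℝ, ℂ)) : Prop where
  integral_eq_one : ∫ x, ρ x = 1
  moment_eq_zero : ∀ k : ℕ, 1 ≤ k → ∫ x : ℝ, (x : ℂ) ^ k * ρ x = 0

/-- The auxiliary data in the construction of the embedding: a covering of the line by relatively
compact open sets `U j`, a smooth partition of unity `χ j` subordinate to it, and test functions
`ψ j` that are equal to one in a neighborhood of the closure of `U j`. -/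
structure Localization (J : Type*) where
  /-- The covering. -/
  U : J → Set ℝ
  isOpen_U : ∀ j, IsOpen (U j)
  isCompact_closure_U : ∀ j, IsCompact (closure (U j))
  iUnion_U : ⋃ j, U j = Set.univ
  /-- The partition of unity. -/
  χ : SmoothPartitionOfUnity J 𝓘(ℝ, ℝ) ℝ Set.univ
  isSubordinate : χ.IsSubordinate U
  /-- The cut-off functions. -/
  ψ : J → Test
  ψ_eq_one : ∀ j, ∀ᶠ x in 𝓝ˢ (closure (U j)), ψ j x = 1

/-- The net `u_ε = ∑ j, χ j ((ψ j w) * ρ_ε)` representing the distribution `w`. The sum is locally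
finite. -/
def embedNet {J : Type*} (ρ : 𝓢(ℝ, ℂ)) (P : Localization J) (w : Distr) : Net :=
  fun ε x => ∑ᶠ j, (P.χ j x : ℂ) * conv w (P.ψ j) (scaled ρ ε) (contDiff_scaled ρ ε) x

theorem embedNet_eq_sum {J : Type*} (ρ : 𝓢(ℝ, ℂ)) (P : Localization J) (w : Distr)
    {K : Set ℝ} (hK : IsCompact K) :
    ∃ v : Net, IsModerate v ∧ ∀ ε, ∀ x ∈ K, embedNet ρ P w ε =ᶠ[𝓝 x] v ε := by
  have hK' : IsCompact (Metric.cthickening 1 K) := hK.cthickening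
  have hfin := P.χ.locallyFinite.finite_nonempty_inter_compact hK'
  let f : J → Net := fun j ε x =>
    (P.χ j x : ℂ) * conv w (P.ψ j) (scaled ρ ε) (contDiff_scaled ρ ε) x
  have hf : ∀ j, IsModerate (f j) := fun j => by
    have hχ : ContDiff ℝ ∞ fun x => (P.χ j x : ℂ) :=
      Complex.ofRealCLM.contDiff.comp (contMDiff_iff_contDiff.1 (P.χ j).contMDiff)
    exact (isModerate_const hχ).mul (isModerate_conv ρ w (P.ψ j))
  refine ⟨∑ j ∈ hfin.toFinset, f j, Subalgebra.sum_mem moderate fun j _ => hf j,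
    fun ε x hx => ?_⟩
  have hnhds : Metric.thickening 1 K ∈ 𝓝 x :=
    Metric.isOpen_thickening.mem_nhds (Metric.self_subset_thickening one_pos K hx)
  filter_upwards [hnhds] with y hy
  rw [Finset.sum_apply, Finset.sum_apply]
  refine finsum_eq_sum_of_support_subset _ fun j hj => ?_
  simp only [Set.Finite.coe_toFinset, Set.mem_ofPred_eq]
  refine ⟨y, fun h0 => hj ?_, Metric.thickening_subset_cthickening 1 K hy⟩
  simp [h0]

theorem isModerate_embedNet {J : Type*} (ρ : 𝓢(ℝ, ℂ)) (P : Localization J) (w : Distr) :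
    IsModerate (embedNet ρ P w) := by
  refine ⟨fun ε => contDiff_iff_contDiffAt.2 fun x => ?_, fun K hK k => ?_⟩
  · obtain ⟨v, hv, h⟩ := embedNet_eq_sum ρ P w (isCompact_singleton (x := x))
    exact (hv.smooth ε).contDiffAt.congr_of_eventuallyEq (h ε x rfl)
  · obtain ⟨v, hv, h⟩ := embedNet_eq_sum ρ P w hK
    obtain ⟨N, C, hC⟩ := hv.bound K hK k
    refine ⟨N, C, hC.mono fun ε hε x hx => ?_⟩
    rw [(h ε x hx).iteratedDeriv_eq k]
    exact hε x hx

/-- The embedding `ι : 𝓓'(ℝ) → 𝓖(ℝ)` determined by a mollifier `ρ`, computed with the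
localization data `P`. -/
def embed {J : Type*} (ρ : 𝓢(ℝ, ℂ)) (P : Localization J) (w : Distr) : ColombeauAlgebra :=
  mk (embedNet ρ P w) (isModerate_embedNet ρ P w)

end Colombeau

end

namespace Colombeau

open MeasureTheory Filter

/-! ### Smooth averages of translates -/

/-! The representing net `u_ε` converges weakly to `w`: `∫ u_ε φ → ⟨w, φ⟩` for every test function
`φ` (`tendsto_integral_embedNet_mul`). Testing `x u_ε' - α u_ε` against `φ` and integrating by parts
moves the operator onto `φ`, giving `∫ u_ε (-(xφ)' - αφ)` (`integral_euler_mul`). This tends to `⟨w,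
-(xφ)' - αφ⟩ = ⟨x w' - α w, φ⟩`. Association asks that the limit be `0`, the equation asks that the
value be `0`; limits being unique, the two conditions agree for each `φ` separately.

Weak convergence has two ingredients. The first is the exchange `∫ ((ψw) * g) θ = ⟨w, ψ ∫ g(x - ·)
θ(x) dx⟩` (`integral_conv_mul`). Truncate the weight `θ` to `(-∞, t]` and let `t` vary: over `(s,
t]` both sides change by `(t - s) θ(s) ((ψw) * g)(s)` up to `O((t - s)²)`. Their difference
therefore has zero derivative in `t`, and it vanishes for `t` far to the left. The second is that `∫
ρ_ε(x - y) θ(x) dx` tends to `θ(y)` uniformly with all derivatives, at rate `O(ε)`, because `ρ` has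
integral one and finite first absolute moment. Continuity of `w` on functions cut off by `ψ` then
gives the limit `⟨w, ψθ⟩`, and the partition of unity patches these local limits together. -/

theorem IsBddSmooth.of_hasCompactSupport {f : ℝ → ℂ} (hf : ContDiff ℝ ∞ f)
    (hc : HasCompactSupport f) : IsBddSmooth f := by
  refine ⟨hf, fun k => ?_⟩
  have hs : HasCompactSupport (_root_.iteratedDeriv k f) := by
    induction k with
    | zero => simpa using hc
    | succ k ih => rw [iteratedDeriv_succ]; exact ih.deriv
  exact hs.exists_bound_of_continuous (hf.continuous_iteratedDeriv k (by exact_mod_cast le_top))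

theorem IsBddSmooth.differentiable {f : ℝ → ℂ} (hf : IsBddSmooth f) : Differentiable ℝ f :=
  hf.smooth.differentiable (by simp)

theorem IsBddSmooth.exists_bound {f : ℝ → ℂ} (hf : IsBddSmooth f) : ∃ M, 0 ≤ M ∧ ∀ x, ‖f x‖ ≤ M := by
  obtain ⟨M, hM⟩ := hf.bound 0
  simp only [iteratedDeriv_zero] at hM
  exact ⟨M, (norm_nonneg _).trans (hM 0), hM⟩

theorem IsBddSmooth.exists_lipschitz {f : ℝ → ℂ} (hf : IsBddSmooth f) :
    ∃ M, 0 ≤ M ∧ ∀ x y, ‖f y - f x‖ ≤ M * |y - x| := by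
  obtain ⟨M, hM0, hM⟩ := hf.deriv.exists_bound
  exact ⟨M, hM0, fun x y => convex_univ.norm_image_sub_le_of_norm_deriv_le
    (fun z _ => hf.differentiable z) (fun z _ => hM z) trivial trivial⟩

/-- The average `y ↦ ∫ f(x + σ y) κ(x) dx` of translates of `f` with weight `κ`. -/
noncomputable def average (σ : ℝ) (f κ : ℝ → ℂ) (y : ℝ) : ℂ := ∫ x, f (x + σ * y) * κ x

theorem IsBddSmooth.integrable_translate_mul {f κ : ℝ → ℂ} (hf : IsBddSmooth f)
    (hκ : Integrable κ) (c : ℝ) : Integrable fun x => f (x + c) * κ x := by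
  obtain ⟨M, -, hM⟩ := hf.exists_bound
  have hc := hf.smooth.continuous
  exact hκ.bdd_mul (c := M) (by fun_prop) (Eventually.of_forall fun x => hM _)

/-- Differentiation under the integral sign, with majorant `|σ| M ‖κ‖`. All smoothness comes from
`f`, so `κ` may be a test function truncated by a jump, as the interchange argument requires. -/
theorem hasDerivAt_average (σ : ℝ) {f κ : ℝ → ℂ} (hf : IsBddSmooth f) (hκ : Integrable κ)
    (y : ℝ) : HasDerivAt (average σ f κ) (σ * average σ (deriv f) κ y) y := by
  obtain ⟨M, -, hM⟩ := hf.deriv.exists_bound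
  have h := (hasDerivAt_integral_of_dominated_loc_of_deriv_le (μ := volume) (𝕜 := ℝ)
    (F := fun y x => f (x + σ * y) * κ x) (F' := fun y x => σ * (deriv f (x + σ * y) * κ x))
    (bound := fun x => |σ| * (M * ‖κ x‖)) (x₀ := y) Filter.univ_mem
    (Eventually.of_forall fun z => (hf.integrable_translate_mul hκ (σ * z)).aestronglyMeasurable)
    (hf.integrable_translate_mul hκ (σ * y))
    ((hf.deriv.integrable_translate_mul hκ (σ * y)).const_mul (σ : ℂ)).aestronglyMeasurable
    (Eventually.of_forall fun x z _ => ?_) ((hκ.norm.const_mul M).const_mul _)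
    (Eventually.of_forall fun x z _ => ?_)).2
  · rwa [integral_const_mul] at h
  · rw [norm_mul, norm_mul, Complex.norm_real, Real.norm_eq_abs]
    gcongr
    exact hM _
  · have h1 : HasDerivAt (fun z => x + σ * z) σ z := by
      simpa using ((hasDerivAt_id z).const_mul σ).const_add x
    have h2 := (((hf.differentiable (x + σ * z)).hasDerivAt.scomp z h1)).mul_const (κ x)
    rw [Complex.real_smul, mul_assoc] at h2
    exact h2

theorem iteratedDeriv_average (σ : ℝ) {f κ : ℝ → ℂ} (hf : IsBddSmooth f) (hκ : Integrable κ)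
    (k : ℕ) : iteratedDeriv k (average σ f κ) =
      fun y => (σ : ℂ) ^ k * average σ (iteratedDeriv k f) κ y := by
  induction k with
  | zero => simp
  | succ k ih =>
    rw [iteratedDeriv_succ, ih]
    ext y
    rw [((hasDerivAt_average σ (hf.iteratedDeriv k) hκ y).const_mul ((σ : ℂ) ^ k)).deriv,
      ← iteratedDeriv_succ, pow_succ, mul_assoc]

theorem contDiff_average (σ : ℝ) {f κ : ℝ → ℂ} (hf : IsBddSmooth f) (hκ : Integrable κ) :
    ContDiff ℝ ∞ (average σ f κ) := by
  refine contDiff_of_differentiable_iteratedDeriv fun n _ => ?_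
  rw [iteratedDeriv_average σ hf hκ]
  exact fun y =>
    ((hasDerivAt_average σ (hf.iteratedDeriv n) hκ y).const_mul _).differentiableAt

/-! ### Rectangle rule and functions with quadratically small increments -/

theorem norm_setIntegral_Ioc_sub_le {f : ℝ → ℂ} (hf : Continuous f) {M s t : ℝ} (hM0 : 0 ≤ M)
    (hst : s ≤ t) (hM : ∀ x ∈ Set.Ioc s t, ‖f x - f s‖ ≤ M * |x - s|) :
    ‖(∫ x in Set.Ioc s t, f x) - (t - s) * f s‖ ≤ M * (t - s) ^ 2 := by
  have hi : IntegrableOn f (Set.Ioc s t) := hf.integrableOn_Ioc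
  have h1 : (∫ x in Set.Ioc s t, f x) - (t - s) * f s = ∫ x in Set.Ioc s t, (f x - f s) := by
    rw [integral_sub hi (by simp), setIntegral_const]
    simp [hst]
  rw [h1]
  refine (norm_setIntegral_le_of_norm_le_const (C := M * (t - s)) (by simp) fun x hx => ?_).trans_eq ?_
  · refine (hM x hx).trans ?_
    rw [abs_of_nonneg (by linarith [hx.1])]
    gcongr
    exact hx.2
  · simp [hst]
    ring

theorem norm_mul_sub_mul_le {a b a' b' : ℂ} {A B L L' : ℝ} (ha : ‖a‖ ≤ A) (hb : ‖b'‖ ≤ B)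
    (hl : ‖a - a'‖ ≤ L) (hl' : ‖b - b'‖ ≤ L') : ‖a * b - a' * b'‖ ≤ A * L' + L * B := by
  rw [show a * b - a' * b' = a * (b - b') + (a - a') * b' by ring]
  refine (norm_add_le _ _).trans ?_
  rw [norm_mul, norm_mul]
  have := (norm_nonneg _).trans ha
  have := (norm_nonneg _).trans hl
  gcongr

/-- Quadratically small increments force the derivative to vanish everywhere. -/
theorem eq_of_dist_le_sq {f : ℝ → ℂ} {C : ℝ}
    (h : ∀ s t, s ≤ t → ‖f t - f s‖ ≤ C * (t - s) ^ 2) (s t : ℝ) : f s = f t := by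
  have h' : ∀ s t, ‖f t - f s‖ ≤ C * ‖(t - s) ^ 2‖ := fun s t => by
    rw [Real.norm_of_nonneg (sq_nonneg _)]
    rcases le_total s t with hst | hst
    · exact h s t hst
    · rw [norm_sub_rev, ← neg_sub s t, neg_sq]
      exact h t s hst
  have hd : ∀ s, HasDerivAt f 0 s := fun s => by
    rw [hasDerivAt_iff_isLittleO_nhds_zero]
    refine Asymptotics.IsBigO.trans_isLittleO (g := fun t : ℝ => t ^ 2) ?_
      (by simpa using Asymptotics.isLittleO_pow_id (𝕜 := ℝ) (n := 2) (by norm_num))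
    refine Asymptotics.IsBigO.of_bound C (Eventually.of_forall fun t => ?_)
    simpa using h' s (s + t)
  exact is_const_of_deriv_eq_zero (fun s => (hd s).differentiableAt) (fun s => (hd s).deriv) s t

end Colombeau

namespace Colombeau

open MeasureTheory Filter

/-! ### Interchanging a distribution with an integral -/

theorem Test.contDiff_ofReal (φ : Test) : ContDiff ℝ ∞ fun x => (φ x : ℂ) :=
  Complex.ofRealCLM.contDiff.comp φ.contDiff

theorem Test.hasCompactSupport_ofReal (φ : Test) : HasCompactSupport fun x => (φ x : ℂ) :=
  φ.hasCompactSupport.comp_left (g := ((↑) : ℝ → ℂ)) rfl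

theorem Test.isBddSmooth_ofReal (φ : Test) : IsBddSmooth fun x => (φ x : ℂ) :=
  .of_hasCompactSupport φ.contDiff_ofReal φ.hasCompactSupport_ofReal

theorem Test.integrable_ofReal (φ : Test) : Integrable fun x => (φ x : ℂ) :=
  φ.contDiff_ofReal.continuous.integrable_of_hasCompactSupport φ.hasCompactSupport_ofReal

theorem average_indicator_Iic_sub (σ : ℝ) {f κ : ℝ → ℂ} (hf : IsBddSmooth f)
    (hκ : Integrable κ) {s t : ℝ} (hst : s ≤ t) (y : ℝ) :
    average σ f ((Set.Iic t).indicator κ) y - average σ f ((Set.Iic s).indicator κ) y =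
      ∫ x in Set.Ioc s t, f (x + σ * y) * κ x := by
  have h (a : ℝ) : average σ f ((Set.Iic a).indicator κ) y =
      ∫ x in Set.Iic a, f (x + σ * y) * κ x := by
    rw [← integral_indicator measurableSet_Iic]
    refine integral_congr_ae (Eventually.of_forall fun x => ?_)
    simp only [Set.indicator_apply]
    split_ifs <;> simp
  have hi := hf.integrable_translate_mul hκ (σ * y)
  rw [h, h, ← intervalIntegral.integral_of_le hst,
    intervalIntegral.integral_Iic_sub_Iic hi.integrableOn hi.integrableOn]

/-- The difference between both sides of `⟨w, ψ ∫ g(x - ·) κ(x) dx⟩ = ∫ ((ψ w) * g)(x) κ(x) dx`. -/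
noncomputable def interchangeDefect (w : Distr) (ψ : Test) {g : ℝ → ℂ} (hg : IsBddSmooth g) (κ : ℝ → ℂ)
    (hκ : Integrable κ) : ℂ :=
  pairing w (cutoff ψ (average (-1) g κ) (contDiff_average (-1) hg hκ)) -
    ∫ x, conv w ψ g hg.smooth x * κ x

theorem pairing_cutoff_sub_sub_mul (w : Distr) (ψ : Test) {f g h : ℝ → ℂ} (hf : ContDiff ℝ ∞ f)
    (hg : ContDiff ℝ ∞ g) (hh : ContDiff ℝ ∞ h) (c : ℝ) :
    pairing w (cutoff ψ f hf) - pairing w (cutoff ψ g hg) - c * pairing w (cutoff ψ h hh) =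
      pairing w (cutoff ψ (fun y => f y - g y - c * h y)
        ((hf.sub hg).sub (contDiff_const.mul hh))) := by
  rw [← Complex.real_smul, ← map_smul, ← map_sub, ← map_sub]
  congr 1
  ext y
  simp [Complex.real_smul]
  ring

/-- Each side of the interchange formula, with weight cut at `s` and at `t`, changes by an integral
over `(s, t]`. The rectangle rule replaces both by the same quantity `(t - s) θ(s) ((ψw) * g)(s)`,
which cancels. On the distribution side the rule must hold for finitely many `y`-derivatives of the
integrand, as many as the order of `w` near the support of `ψ` demands. -/
theorem exists_interchangeDefect_bound (w : Distr) (ψ : Test) {g : ℝ → ℂ} (hg : IsBddSmooth g)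
    (θ : Test) : ∃ C, ∀ s t, s ≤ t →
      ‖interchangeDefect w ψ hg _ (θ.integrable_ofReal.indicator (measurableSet_Iic (a := t))) -
        interchangeDefect w ψ hg _ (θ.integrable_ofReal.indicator (measurableSet_Iic (a := s)))‖ ≤
        C * (t - s) ^ 2 := by
  obtain ⟨m, C, hC, hb⟩ := exists_bound_cutoff w ψ
  choose A hA0 hA using fun k => (hg.iteratedDeriv k).exists_bound
  choose L hL0 hL using fun k => (hg.iteratedDeriv k).exists_lipschitz
  obtain ⟨B, hB0, hB⟩ := θ.isBddSmooth_ofReal.exists_bound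
  obtain ⟨L', hL'0, hL'⟩ := θ.isBddSmooth_ofReal.exists_lipschitz
  have hconv : IsBddSmooth fun x => conv w ψ g hg.smooth x * (θ x : ℂ) :=
    .of_hasCompactSupport ((contDiff_conv w ψ hg).mul θ.contDiff_ofReal)
      θ.hasCompactSupport_ofReal.mul_left
  obtain ⟨N, hN0, hN⟩ := hconv.exists_lipschitz
  -- The `k`-th summand is a Lipschitz constant, uniform in `y`, of `x ↦ g⁽ᵏ⁾(x - y) θ(x)`; the sum
  -- dominates all orders `k ≤ m` at once.
  set S : ℝ := ∑ k ∈ Finset.range (m + 1), (A k * L' + L k * B)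
  have hS0 : ∀ k, 0 ≤ A k * L' + L k * B := fun k => by
    have := hA0 k
    have := hL0 k
    positivity
  refine ⟨C * S + N, fun s t hst => ?_⟩
  have hIs := θ.integrable_ofReal.indicator (measurableSet_Iic (a := s))
  have hIt := θ.integrable_ofReal.indicator (measurableSet_Iic (a := t))
  -- Since `θ` is real, the factor `(t - s) θ(s)` is a real scalar, and the real linearity of
  -- `pairing w` suffices to bring it inside.
  have hleft : ‖pairing w (cutoff ψ _ (contDiff_average (-1) hg hIt)) -
      pairing w (cutoff ψ _ (contDiff_average (-1) hg hIs)) -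
      ((t - s) * θ s : ℝ) * conv w ψ g hg.smooth s‖ ≤ C * S * (t - s) ^ 2 := by
    rw [conv, pairing_cutoff_sub_sub_mul, mul_assoc]
    refine hb _ _ _ (mul_nonneg (Finset.sum_nonneg fun k _ => hS0 k) (sq_nonneg _))
      fun k hk y => ?_
    rw [iteratedDeriv_sub_sub_mul (contDiff_average (-1) hg hIt) (contDiff_average (-1) hg hIs)
      (contDiff_reflect hg.smooth s), iteratedDeriv_average _ hg hIt,
      iteratedDeriv_average _ hg hIs, iteratedDeriv_comp_const_sub]
    set G := iteratedDeriv k g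
    have hGb : IsBddSmooth G := hg.iteratedDeriv k
    -- Each `y`-derivative produces the common sign `(-1)^k`; what remains is the rectangle error of
    -- `x ↦ G(x - y) θ(x)` on `(s, t]`.
    have e : ((-1 : ℝ) : ℂ) ^ k * average (-1) G ((Set.Iic t).indicator fun x => (θ x : ℂ)) y -
        ((-1 : ℝ) : ℂ) ^ k * average (-1) G ((Set.Iic s).indicator fun x => (θ x : ℂ)) y -
        ((t - s) * θ s : ℝ) * ((-1 : ℝ) ^ k • G (s - y)) =
        (-1) ^ k * ((∫ x in Set.Ioc s t, G (x + -1 * y) * (θ x : ℂ)) -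
          (t - s) * (G (s + -1 * y) * (θ s : ℂ))) := by
      rw [← average_indicator_Iic_sub (-1) hGb θ.integrable_ofReal hst, Complex.real_smul,
        show s + -1 * y = s - y by ring]
      push_cast
      ring
    have hcont : Continuous fun x => G (x + -1 * y) * (θ x : ℂ) := by
      have := hGb.smooth.continuous
      have := θ.contDiff_ofReal.continuous
      fun_prop
    rw [e, norm_mul, norm_pow, norm_neg, norm_one, one_pow, one_mul]
    refine (norm_setIntegral_Ioc_sub_le hcont (hS0 k) hst fun x _ => ?_).trans ?_
    · refine (norm_mul_sub_mul_le (hA k _) (hB _) (hL k _ _) (hL' s x)).trans_eq ?_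
      rw [show x + -1 * y - (s + -1 * y) = x - s by ring]
      ring
    · gcongr
      exact Finset.single_le_sum (f := fun k => A k * L' + L k * B) (fun k _ => hS0 k)
        (Finset.mem_range.2 (by omega))
  have hright := norm_setIntegral_Ioc_sub_le hconv.smooth.continuous hN0 hst
    fun x _ => hN s x
  have hconv_int (a : ℝ) : ∫ x, conv w ψ g hg.smooth x * (Set.Iic a).indicator
      (fun x => (θ x : ℂ)) x = ∫ x in Set.Iic a, conv w ψ g hg.smooth x * (θ x : ℂ) := by
    rw [← integral_indicator measurableSet_Iic]
    refine integral_congr_ae (Eventually.of_forall fun x => ?_)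
    simp only [Set.indicator_apply]
    split_ifs <;> simp
  have hi : Integrable fun x => conv w ψ g hg.smooth x * (θ x : ℂ) :=
    hconv.smooth.continuous.integrable_of_hasCompactSupport θ.hasCompactSupport_ofReal.mul_left
  have hdiff := intervalIntegral.integral_Iic_sub_Iic (a := s) (b := t) hi.integrableOn
    hi.integrableOn
  rw [intervalIntegral.integral_of_le hst] at hdiff
  rw [← hdiff] at hright
  rw [interchangeDefect, interchangeDefect, hconv_int, hconv_int, add_mul]
  refine le_trans (le_of_eq ?_) ((norm_sub_le _ _).trans (add_le_add hleft hright))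
  congr 1
  push_cast
  ring

theorem integral_conv_mul (w : Distr) (ψ : Test) {g : ℝ → ℂ} (hg : IsBddSmooth g) (θ : Test) :
    ∫ x, conv w ψ g hg.smooth x * (θ x : ℂ) =
      pairing w (cutoff ψ _ (contDiff_average (-1) hg θ.integrable_ofReal)) := by
  obtain ⟨C, hC⟩ := exists_interchangeDefect_bound w ψ hg θ
  obtain ⟨R, hR⟩ := θ.hasCompactSupport.isCompact.isBounded.subset_closedBall 0
  have hzero : ∀ x, θ x ≠ 0 → |x| ≤ R := fun x hx => by
    simpa using hR (subset_tsupport _ hx)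
  -- The margin `1` keeps the half-line clear of the endpoint `-R`, which the bound `|x| ≤ R` does
  -- not exclude.
  have hlow : (Set.Iic (-R - 1)).indicator (fun x => (θ x : ℂ)) = 0 := by
    ext x
    rw [Pi.zero_apply, Set.indicator_apply_eq_zero]
    intro hx
    by_contra h
    have h1 := neg_le_of_abs_le (hzero x (by simpa using h))
    have := Set.mem_Iic.1 hx
    linarith
  have hhigh : (Set.Iic R).indicator (fun x => (θ x : ℂ)) = fun x => (θ x : ℂ) := by
    refine Set.indicator_eq_self.2 fun x hx => ?_
    exact le_of_abs_le (hzero x (by simpa using hx))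
  -- The defect carries a proof of integrability that depends on the weight, so an equality of
  -- weights is transported along with its proof.
  have hcongr : ∀ {κ κ' : ℝ → ℂ} (h : κ = κ') (hκ : Integrable κ) (hκ' : Integrable κ'),
      interchangeDefect w ψ hg κ hκ = interchangeDefect w ψ hg κ' hκ' := by
    rintro κ _ rfl _ _
    rfl
  have h0 : interchangeDefect w ψ hg 0 (integrable_zero _ _ _) = 0 := by
    have : cutoff ψ (average (-1) g 0) (contDiff_average (-1) hg (integrable_zero _ _ _)) = 0 := by
      ext y
      simp [average]
    simp [interchangeDefect, this]
  have key := eq_of_dist_le_sq (f := fun t => interchangeDefect w ψ hg _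
    (θ.integrable_ofReal.indicator (measurableSet_Iic (a := t)))) hC (-R - 1) R
  beta_reduce at key
  rw [hcongr hlow _ (integrable_zero _ _ _), h0, hcongr hhigh _ θ.integrable_ofReal] at key
  exact (sub_eq_zero.1 key.symm).symm

end Colombeau

namespace Colombeau

open MeasureTheory Filter

/-! ### The embedded net converges weakly to the distribution -/

/-- Translation by `y` moves the variable from one factor to the other. Hence derivatives in `y` can
be made to fall on either factor: on the mollifier or on the test function. -/
theorem average_neg_one_comm (f g : ℝ → ℂ) : average (-1) g f = average 1 f g := by
  ext y
  rw [average, ← integral_add_right_eq_self _ y, average]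
  simp [mul_comm]

theorem average_scaled_eq (ρ : 𝓢(ℝ, ℂ)) (ε : Eps) (f : ℝ → ℂ) (y : ℝ) :
    average (-1) (scaled ρ ε) f y = ∫ s : ℝ, f (ε * s + y) * ρ s := by
  have hε := ε.pos
  have h := Measure.integral_comp_div (fun s : ℝ => ((ε : ℝ)⁻¹ : ℝ) • (f (ε * s + y) * ρ s)) ε
  rw [integral_smul _ fun s : ℝ => f (ε * s + y) * ρ s, smul_smul, abs_of_pos hε,
    mul_inv_cancel₀ hε.ne', one_smul] at h
  rw [average_neg_one_comm, average, ← h]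
  refine integral_congr_ae (Eventually.of_forall fun x => ?_)
  simp only [scaled, Complex.real_smul, mul_div_cancel₀ x hε.ne', one_mul]
  ring

theorem integrable_abs_mul_norm (ρ : 𝓢(ℝ, ℂ)) : Integrable fun s : ℝ => |s| * ‖ρ s‖ := by
  simpa using ρ.integrable_pow_mul volume 1

/-- As `∫ ρ = 1`, the error equals `∫ (f(εs + y) - f(y)) ρ(s) ds`, and the Lipschitz bound
contributes the factor `L ε |s|`. -/
theorem norm_average_scaled_sub_le {ρ : 𝓢(ℝ, ℂ)} (hρ : ∫ x, ρ x = 1) (ε : Eps) {f : ℝ → ℂ}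
    (hf : IsBddSmooth f) {L : ℝ} (hL : ∀ x y, ‖f y - f x‖ ≤ L * |y - x|) (y : ℝ) :
    ‖average (-1) (scaled ρ ε) f y - f y‖ ≤ L * (∫ s, |s| * ‖ρ s‖) * ε := by
  have hε := ε.pos
  obtain ⟨M, -, hM⟩ := hf.exists_bound
  have hc := hf.smooth.continuous
  have hi : Integrable fun s : ℝ => f (ε * s + y) * ρ s :=
    ρ.integrable.bdd_mul (c := M) (by fun_prop) (Eventually.of_forall fun x => hM _)
  have e : average (-1) (scaled ρ ε) f y - f y = ∫ s : ℝ, (f (ε * s + y) - f y) * ρ s := by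
    simp_rw [sub_mul]
    rw [integral_sub hi (ρ.integrable.const_mul _), integral_const_mul, hρ, mul_one,
      average_scaled_eq]
  rw [e]
  refine (norm_integral_le_of_norm_le ((integrable_abs_mul_norm ρ).const_mul (L * ε))
    (Eventually.of_forall fun s => ?_)).trans_eq ?_
  · rw [norm_mul, ← mul_assoc]
    gcongr
    refine (hL _ _).trans_eq ?_
    rw [add_sub_cancel_right, abs_mul, abs_of_pos hε, mul_assoc]
  · rw [integral_const_mul]
    ring

theorem tendsto_val_epsZero : Tendsto (fun ε : Eps => (ε : ℝ)) epsZero (𝓝 0) := tendsto_comap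

/-- Needed for uniqueness of limits as `ε → 0`: every neighborhood of `0` meets `(0, 1]`. -/
instance : epsZero.NeBot := by
  refine comap_neBot fun t ht => ?_
  have h : t ∩ Set.Ioc 0 1 ∈ 𝓝[>] (0 : ℝ) :=
    inter_mem (mem_nhdsWithin_of_mem_nhds ht) (Ioc_mem_nhdsGT one_pos)
  obtain ⟨x, hx⟩ := (inferInstance : (𝓝[>] (0 : ℝ)).NeBot).nonempty_of_mem h
  exact ⟨⟨x, hx.2⟩, hx.1⟩

theorem pairing_cutoff_sub (w : Distr) (ψ : Test) {f g : ℝ → ℂ} (hf : ContDiff ℝ ∞ f)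
    (hg : ContDiff ℝ ∞ g) :
    pairing w (cutoff ψ f hf) - pairing w (cutoff ψ g hg) =
      pairing w (cutoff ψ (f - g) (hf.sub hg)) := by
  rw [← map_sub]
  congr 1
  ext y
  simp [mul_sub]

theorem pairing_cutoff_ofReal (w : Distr) (ψ θ : Test) :
    pairing w (cutoff ψ _ θ.contDiff_ofReal) = w (mulTest ψ.contDiff θ) := by
  have hre : TestFunction.postcompCLM Complex.reCLM (cutoff ψ _ θ.contDiff_ofReal) =
      mulTest ψ.contDiff θ := by
    ext y
    simp
  have him : TestFunction.postcompCLM Complex.imCLM (cutoff ψ _ θ.contDiff_ofReal) =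
      (0 : Test) := by
    ext y
    simp
  rw [pairing_apply, hre, him, map_zero, mul_zero, add_zero]

theorem integrable_scaled (ρ : 𝓢(ℝ, ℂ)) (ε : Eps) : Integrable (scaled ρ ε) :=
  (ρ.integrable.comp_div ε.pos.ne').smul ((ε : ℝ)⁻¹)

/-- After the interchange, the difference from the limit is `w` applied to `ψ` times the
mollification error of `θ`, whose derivatives up to the relevant order are all `O(ε)`. -/
theorem tendsto_integral_conv_mul {ρ : 𝓢(ℝ, ℂ)} (hρ : ∫ x, ρ x = 1) (w : Distr) (ψ θ : Test) :
    Tendsto (fun ε => ∫ x, conv w ψ (scaled ρ ε) (contDiff_scaled ρ ε) x * (θ x : ℂ)) epsZero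
      (𝓝 (w (mulTest ψ.contDiff θ))) := by
  obtain ⟨m, C, hC, hb⟩ := exists_bound_cutoff w ψ
  have hθ := θ.isBddSmooth_ofReal
  choose L hL0 hL using fun k => (hθ.iteratedDeriv k).exists_lipschitz
  set I := ∫ s, |s| * ‖ρ s‖
  have hI0 : 0 ≤ I := integral_nonneg fun s => by positivity
  set S : ℝ := ∑ k ∈ Finset.range (m + 1), L k * I
  have hS0 : 0 ≤ S := Finset.sum_nonneg fun k _ => mul_nonneg (hL0 k) hI0
  rw [tendsto_iff_norm_sub_tendsto_zero]
  refine squeeze_zero (fun _ => norm_nonneg _) (g := fun ε : Eps => C * (S * ε)) (fun ε => ?_) ?_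
  · have hε := ε.pos
    have hav := contDiff_average (-1) (isBddSmooth_scaled ρ ε) θ.integrable_ofReal
    rw [integral_conv_mul w ψ (isBddSmooth_scaled ρ ε) θ, ← pairing_cutoff_ofReal,
      pairing_cutoff_sub]
    refine hb _ _ _ (by positivity) fun k hk y => ?_
    -- Writing the average with `σ = 1` lets all derivatives fall on `θ`, whose bounds do not depend
    -- on `ε`; on `ρ_ε` they would cost powers of `ε⁻¹`.
    rw [iteratedDeriv_sub (contDiffAt_of_smooth hav k y)
      (contDiffAt_of_smooth θ.contDiff_ofReal k y), average_neg_one_comm,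
      iteratedDeriv_average 1 hθ (integrable_scaled ρ ε), Complex.ofReal_one, one_pow]
    simp only [one_mul]
    rw [← average_neg_one_comm]
    refine (norm_average_scaled_sub_le hρ ε (hθ.iteratedDeriv k) (hL k) y).trans ?_
    gcongr
    exact Finset.single_le_sum (f := fun k => L k * I) (fun k _ => mul_nonneg (hL0 k) hI0)
      (Finset.mem_range.2 (by omega))
  · simpa using (tendsto_val_epsZero.const_mul S).const_mul C

theorem tendsto_integral_embedNet_mul {J : Type*} {ρ : 𝓢(ℝ, ℂ)} (hρ : ∫ x, ρ x = 1)
    (P : Localization J) (w : Distr) (φ : Test) :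
    Tendsto (fun ε => ∫ x, embedNet ρ P w ε x * (φ x : ℂ)) epsZero (𝓝 (w φ)) := by
  have hfin := P.χ.locallyFinite.finite_nonempty_inter_compact φ.hasCompactSupport.isCompact
  set F := hfin.toFinset
  have hF : ∀ j x, P.χ j x ≠ 0 → φ x ≠ 0 → j ∈ F := fun j x hj hx =>
    hfin.mem_toFinset.2 ⟨x, hj, subset_tsupport _ hx⟩
  have hχ : ∀ j, ContDiff ℝ ∞ (P.χ j) := fun j => contMDiff_iff_contDiff.1 (P.χ j).contMDiff
  have hnet : ∀ ε, ∫ x, embedNet ρ P w ε x * (φ x : ℂ) = ∑ j ∈ F,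
      ∫ x, conv w (P.ψ j) (scaled ρ ε) (contDiff_scaled ρ ε) x * (mulTest (hχ j) φ x : ℂ) := by
    intro ε
    rw [← integral_finsetSum]
    · refine integral_congr_ae (Eventually.of_forall fun x => ?_)
      by_cases hx : φ x = 0
      · simp [hx]
      · have h1 : embedNet ρ P w ε x = ∑ j ∈ F, (P.χ j x : ℂ) *
            conv w (P.ψ j) (scaled ρ ε) (contDiff_scaled ρ ε) x :=
          finsum_eq_sum_of_support_subset _ fun j hj => hF j x (fun h0 => hj (by simp [h0])) hx
        simp only [h1, Finset.sum_mul, mulTest_apply]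
        refine Finset.sum_congr rfl fun j _ => ?_
        push_cast
        ring
    · intro j _
      exact ((contDiff_conv w (P.ψ j) (isBddSmooth_scaled ρ ε)).continuous.mul
        (Test.contDiff_ofReal _).continuous).integrable_of_hasCompactSupport
        (Test.hasCompactSupport_ofReal _).mul_left
  -- Where `χ j ≠ 0` one has `ψ j = 1`, so the cut-offs drop out and `∑ χ j = 1` restores `φ`. The
  -- finite set `F` contains every index active at a point where `φ ≠ 0`.
  have hφ : ∑ j ∈ F, mulTest (P.ψ j).contDiff (mulTest (hχ j) φ) = φ := by
    have hcoe : ∀ x, (∑ j ∈ F, mulTest (P.ψ j).contDiff (mulTest (hχ j) φ)) x =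
        ∑ j ∈ F, mulTest (P.ψ j).contDiff (mulTest (hχ j) φ) x := fun x => by
      induction F using Finset.cons_induction with
      | empty => rfl
      | cons j s hj ih =>
        rw [Finset.sum_cons, Finset.sum_cons, ← ih]
        rfl
    ext x
    rw [hcoe]
    by_cases hx : φ x = 0
    · simp [hx]
    · have hsum := P.χ.sum_eq_one (Set.mem_univ x)
      rw [finsum_eq_sum_of_support_subset (s := F) _ fun j hj => hF j x hj hx] at hsum
      calc ∑ j ∈ F, mulTest (P.ψ j).contDiff (mulTest (hχ j) φ) x
          = ∑ j ∈ F, P.χ j x * φ x := Finset.sum_congr rfl fun j _ => by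
            rw [mulTest_apply, mulTest_apply]
            by_cases hj : P.χ j x = 0
            · simp [hj]
            · have hxU : x ∈ closure (P.U j) :=
                subset_closure (P.isSubordinate j (subset_tsupport _ hj))
              rw [(P.ψ_eq_one j).self_of_nhdsSet x hxU, one_mul]
        _ = φ x := by rw [← Finset.sum_mul, hsum, one_mul]
  simp_rw [hnet]
  conv => rhs; rw [← hφ, map_sum]
  exact tendsto_finsetSum _ fun j _ => tendsto_integral_conv_mul hρ w (P.ψ j) _

/-! ### Association and the equation -/

theorem IsNegligible.tendsto_integral_mul {n : Net} (hn : IsNegligible n) (φ : Test) :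
    Tendsto (fun ε => ∫ x, n ε x * (φ x : ℂ)) epsZero (𝓝 0) := by
  -- Order zero and a single power of `ε` on the support of `φ` suffice.
  obtain ⟨C, h⟩ := hn.bound _ φ.hasCompactSupport.isCompact 0 1
  have hφ := φ.integrable_ofReal.norm
  refine squeeze_zero_norm' (a := fun ε : Eps => C * ε * ∫ x, ‖(φ x : ℂ)‖) ?_ ?_
  · filter_upwards [h] with ε hε
    refine (norm_integral_le_of_norm_le (hφ.const_mul (C * ε))
      (Eventually.of_forall fun x => ?_)).trans_eq (integral_const_mul _ _)
    by_cases hx : φ x = 0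
    · simp [hx]
    · rw [norm_mul]
      gcongr
      simpa using hε x (subset_tsupport _ hx)
  · simpa using (tendsto_val_epsZero.const_mul C).mul_const (∫ x, ‖(φ x : ℂ)‖)

theorem integrable_mul_test {f : ℝ → ℂ} (hf : ContDiff ℝ ∞ f) (φ : Test) :
    Integrable fun x => f x * (φ x : ℂ) :=
  (hf.continuous.mul φ.contDiff_ofReal.continuous).integrable_of_hasCompactSupport
    φ.hasCompactSupport_ofReal.mul_left

theorem isNegligible_sub_of_mk_eq {f g : Net} {hf : IsModerate f} {hg : IsModerate g}
    (h : mk f hf = mk g hg) : IsNegligible (f - g) :=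
  Ideal.Quotient.eq.1 h

/-- Association may be tested on any given representatives: `f - g = (f' - g') + (f - f') - (g -
g')`, and the last two differences are negligible, so their integrals against `φ` tend to zero. -/
theorem assoc_mk_iff {f g : Net} (hf : IsModerate f) (hg : IsModerate g) :
    Assoc (mk f hf) (mk g hg) ↔ ∀ φ : Test,
      Tendsto (fun ε => ∫ x, (f ε x - g ε x) * (φ x : ℂ)) epsZero (𝓝 0) := by
  refine ⟨?_, fun h => ⟨f, g, hf, hg, rfl, rfl, h⟩⟩
  rintro ⟨f', g', hf', hg', hff', hgg', h⟩ φ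
  have h1 := (isNegligible_sub_of_mk_eq hff').tendsto_integral_mul φ
  have h2 := (isNegligible_sub_of_mk_eq hgg').tendsto_integral_mul φ
  have h3 := ((h φ).add h1).sub h2
  rw [add_zero, sub_zero] at h3
  refine h3.congr fun ε => ?_
  have i1 := integrable_mul_test ((hf'.smooth ε).sub (hg'.smooth ε)) φ
  have i2 := integrable_mul_test ((hf.smooth ε).sub (hf'.smooth ε)) φ
  have i3 := integrable_mul_test ((hg.smooth ε).sub (hg'.smooth ε)) φ
  simp only [Pi.sub_apply] at i1 i2 i3 ⊢
  have i12 := i1.add i2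
  simp only [Pi.add_def] at i12
  rw [← integral_add i1 i2, ← integral_sub i12 i3]
  refine integral_congr_ae (Eventually.of_forall fun x => ?_)
  ring

/-- The transpose `φ ↦ -(x φ)' - α φ` of the operator `x d/dx - α`. -/
noncomputable def eulerTranspose (α : ℝ) (φ : Test) : Test :=
  -∂_{(1 : ℝ)} (mulTest (f := fun x : ℝ => x) contDiff_id φ) - α • φ

theorem eulerTranspose_apply (α : ℝ) (φ : Test) (x : ℝ) :
    eulerTranspose α φ x = -deriv (fun y => y * φ y) x - α * φ x := by
  have h : (∂_{(1 : ℝ)} (mulTest (f := fun x : ℝ => x) contDiff_id φ)) x =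
      deriv (fun y => y * φ y) x := by
    rw [TestFunction.lineDerivOp_eq_lineDerivCLM ℝ, TestFunction.lineDerivCLM_eq_fderivCLM,
      TestFunction.fderivCLM_apply_of_le _ le_top]
    exact fderiv_apply_one_eq_deriv
  rw [← h]
  rfl

theorem mulDistr_lineDeriv_eq_smul_iff (w : Distr) (α : ℝ) :
    mulDistr (f := fun x : ℝ => x) contDiff_id (∂_{(1 : ℝ)} w) = α • w ↔
      ∀ φ : Test, w (eulerTranspose α φ) = 0 := by
  have h : ∀ φ : Test, w (eulerTranspose α φ) =
      mulDistr (f := fun x : ℝ => x) contDiff_id (∂_{(1 : ℝ)} w) φ - (α • w) φ := fun φ => by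
    rw [mulDistr_apply, Distribution.lineDerivOp_apply_apply, eulerTranspose, map_sub, map_smul]
    rfl
  simp_rw [h, sub_eq_zero]
  exact DFunLike.ext_iff

/-- Integration by parts against `x φ`, whose compact support removes the boundary terms. -/
theorem integral_euler_mul {u : ℝ → ℂ} (hu : ContDiff ℝ ∞ u) (α : ℝ) (φ : Test) :
    ∫ x : ℝ, (x * deriv u x - α * u x) * (φ x : ℂ) = ∫ x, u x * (eulerTranspose α φ x : ℂ) := by
  set θ : Test := mulTest (f := fun x : ℝ => x) contDiff_id φ with hθ
  have hdu : ContDiff ℝ ∞ (deriv u) := (contDiff_infty_iff_deriv.1 hu).2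
  have hdθ : ∀ x, HasDerivAt (fun y => (θ y : ℂ)) (deriv (fun y => y * φ y) x : ℝ) x := fun x =>
    (θ.contDiff.differentiable (by simp) x).hasDerivAt.ofReal_comp
  have hdt (x : ℝ) : ((deriv (fun y => y * φ y) x : ℝ) : ℂ) =
      -(eulerTranspose α φ x : ℂ) - α * (φ x : ℂ) := by
    rw [eulerTranspose_apply]
    push_cast
    ring
  -- By `hdt`, `(xφ)'` is a linear combination of the test functions `eulerTranspose α φ` and `φ`,
  -- hence integrable against `u`.
  have i1 : Integrable fun x => u x * ((deriv (fun y => y * φ y) x : ℝ) : ℂ) := by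
    simp_rw [hdt]
    refine ((integrable_mul_test hu (eulerTranspose α φ)).neg.sub
      ((integrable_mul_test hu φ).const_mul (α : ℂ))).congr (Eventually.of_forall fun x => ?_)
    simp only [Pi.neg_apply, Pi.sub_apply]
    ring
  have hparts := integral_mul_deriv_eq_deriv_mul_of_integrable
    (fun x _ => (hu.differentiable (by simp) x).hasDerivAt) (fun x _ => hdθ x) i1
    (integrable_mul_test hdu θ) (integrable_mul_test hu θ)
  have hl : ∀ x : ℝ, (x * deriv u x - α * u x) * (φ x : ℂ) =
      deriv u x * (θ x : ℂ) - α * (u x * (φ x : ℂ)) := fun x => by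
    rw [hθ, mulTest_apply]
    push_cast
    ring
  have hr : ∀ x : ℝ, u x * (eulerTranspose α φ x : ℂ) =
      -(u x * ((deriv (fun y => y * φ y) x : ℝ) : ℂ)) - α * (u x * (φ x : ℂ)) := fun x => by
    rw [hdt]
    ring
  have i2 := (integrable_mul_test hu φ).const_mul (α : ℂ)
  simp_rw [hl, hr]
  have i3 := i1.neg
  simp only [Pi.neg_def] at i3
  rw [integral_sub (integrable_mul_test hdu θ) i2, integral_sub i3 i2, integral_neg, hparts,
    neg_neg]

end Colombeau

/-! ### The equivalence -/

theorem mainTheorem9 {J : Type*} (ρ : 𝓢(ℝ, ℂ)) (hρ : Colombeau.IsMollifier ρ)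
    (P : Colombeau.Localization J) (w : Colombeau.Distr) (u : Colombeau.ColombeauAlgebra)
    (hu : u = Colombeau.embed ρ P w) (α : ℝ) :
    Colombeau.mulDistr (f := fun x : ℝ => x) contDiff_id (∂_{(1 : ℝ)} w) = α • w ↔
      Colombeau.Assoc (Colombeau.X * Colombeau.D u) ((α : ℂ) • u) := by
  subst hu
  have hv := Colombeau.isModerate_embedNet ρ P w
  set v := Colombeau.embedNet ρ P w
  have hX := Colombeau.isModerate_const (f := fun x : ℝ => (x : ℂ)) Complex.ofRealCLM.contDiff
  have e1 : Colombeau.X * Colombeau.D (Colombeau.embed ρ P w) =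
      Colombeau.mk _ (hX.mul hv.deriv) := rfl
  have hαv : Colombeau.IsModerate ((α : ℂ) • v) := Colombeau.moderate.smul_mem hv (α : ℂ)
  have e2 : (α : ℂ) • Colombeau.embed ρ P w = Colombeau.mk _ hαv := rfl
  rw [e1, e2, Colombeau.assoc_mk_iff, Colombeau.mulDistr_lineDeriv_eq_smul_iff]
  -- Both conditions now quantify over the same `φ`, and for each one the integrals tend to `w
  -- (eulerTranspose α φ)`; they tend to `0` exactly when this value is `0`.
  refine forall_congr' fun φ => ?_
  have hlim := Colombeau.tendsto_integral_embedNet_mul hρ.integral_eq_one P w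
    (Colombeau.eulerTranspose α φ)
  have hlim' : Filter.Tendsto (fun ε => ∫ x : ℝ, (x * deriv (v ε) x - α * v ε x) * (φ x : ℂ))
      Colombeau.epsZero (𝓝 (w (Colombeau.eulerTranspose α φ))) :=
    hlim.congr fun ε => (Colombeau.integral_euler_mul (hv.smooth ε) α φ).symm
  exact ⟨fun h => h ▸ hlim', fun h => tendsto_nhds_unique hlim' h⟩
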